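/- Let $A$ be a $C^*$-algebra, not necessarily unital, with multiplier algebra $M(A)$, and let $(A,\alpha,L)$ be an Exel system. That is, $\alpha$ is an endomorphism of $A$ which extends to a strictly continuous endomorphism of $M(A)$, and $L:A\to A$ is a bounded positive linear map which extends to a bounded positive linear map $\overline{L}:M(A)\to M(A)$ such that $L(\alpha(a)m)=a\overline{L}(m)$ for all $a\in A$ and $m\in M(A)$. A Toeplitz-covariant representation of $(A,\alpha,L)$ in a $C^*$-algebra $B$ is a pair $(\pi,V)$ consisting of a nondegenerate homomorphism $\pi:A\to B$ and an element $V\in M(B)$ such that $V\pi(a)=\pi(\alpha(a))V$ and $V^*\pi(a)V=\pi(L(a))$ for all $a\in A$. The Toeplitz crossed product $\mathcal{T}(A,\alpha,L)$ is the $C^*$-algebra generated by a universal Toeplitz-covariant representation $(i,S)$; here "generated" means generated by $i(A)\cup i(A)S$. Let $M_L$ be the Hilbert $A$-bimodule obtained by completing $A$ in the seminorm $\|m\|=\|L(m^*m)\|^{1/2}$, where the pairing is $\langle m,n\rangle=L(m^*n)$, the right action is $m\cdot a=m\alpha(a)$ and the left action is $a\cdot m=am$. Let $q:A\to M_L$ be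 the canonical map. A Toeplitz representation of a Hilbert $A$-bimodule $M$ in a $C^*$-algebra $B$ is a pair $(\psi,\pi)$ consisting of a linear map $\psi:M\to B$ and a homomorphism $\pi:A\to B$ such that $\psi(x\cdot a)=\psi(x)\pi(a)$, $\psi(x)^*\psi(y)=\pi(\langle x,y\rangle)$ and $\psi(a\cdot x)=\pi(a)\psi(x)$ for all $x,y\in M$ and $a\in A$. The Toeplitz algebra $\mathcal{T}(M)$ is the $C^*$-algebra generated by a universal Toeplitz representation $(i_M,i_A)$. Proposition 3.1. The algebras $\mathcal{T}(A,\alpha,L)$ and $\mathcal{T}(M_L)$ exist. There is a linear map $\psi_S:M_L\to\mathcal{T}(A,\alpha,L)$ such that $\psi_S(q(a))=i(a)S$ for all $a\in A$, and such that $(\psi_S,i)$ is a Toeplitz representation of $M_L$ in $\mathcal{T}(A,\alpha,L)$. Its integrated form $\psi_S\times i$, which is the homomorphism of $\mathcal{T}(M_L)$ satisfying $(\psi_S\times i)\circ i_{M_L}=\psi_S$ and $(\psi_S\times i)\circ i_A=i$, is an isomorphism of $\mathcal{T}(M_L)$ onto $\mathcal{T}(A,\alpha,L)$. -/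

import Mathlib

open scoped MultiplierAlgebra

/-! `C⋆`-algebras are not assumed to have an identity.  They carry their standard order, in which
`0 ≤ a` means that `a` is self-adjoint with nonnegative spectrum (equivalently `a = b⋆ b`). -/
attribute [local instance] CStarAlgebra.spectralOrder CStarAlgebra.spectralOrderedRing

universe u v

noncomputable section

/-! ### Multipliers

`𝓜(ℂ, A)` is the multiplier algebra.  For `m : 𝓜(ℂ, A)` and `a : A`, the product `m a` (an element
of `A`) is `m.fst a`, and the product `a m` is `m.snd a`. -/

/-- The strict topology on the multiplier algebra: the coarsest topology for which `m ↦ m a` and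
`m ↦ a m` are norm-continuous for every `a : A`. -/
abbrev strictTopology (A : Type u) [NonUnitalCStarAlgebra A] : TopologicalSpace 𝓜(ℂ, A) :=
  TopologicalSpace.induced
    (fun m : 𝓜(ℂ, A) => ((fun a : A => m.fst a, fun a : A => m.snd a) : (A → A) × (A → A)))
    inferInstance

/-- A homomorphism `π : A → B` is nondegenerate if `π(A) B` spans a dense subspace of `B`. -/
def IsNondegenerate {A : Type u} {B : Type v} [NonUnitalCStarAlgebra A] [NonUnitalCStarAlgebra B]
    (π : A →⋆ₙₐ[ℂ] B) : Prop :=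
  Dense (Submodule.span ℂ {x : B | ∃ (a : A) (b : B), x = π a * b} : Set B)

/-- For a nondegenerate `φ : A → B` with its unique extension `φ' : M(A) → M(B)`, this says that
`φ' m = n`; the extension is determined by `φ' m * φ a = φ (m a)` and `φ a * φ' m = φ (a m)`. -/
def ExtensionMapsTo {A : Type u} {B : Type v} [NonUnitalCStarAlgebra A] [NonUnitalCStarAlgebra B]
    (φ : A →⋆ₙₐ[ℂ] B) (m : 𝓜(ℂ, A)) (n : 𝓜(ℂ, B)) : Prop :=
  (∀ a : A, n.fst (φ a) = φ (m.fst a)) ∧ (∀ a : A, n.snd (φ a) = φ (m.snd a))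

/-! ### Exel systems -/

/-- An Exel system `(A, α, L)`: an extendible endomorphism `α` of `A` together with a transfer
operator `L` for `α`. -/
structure ExelSystem (A : Type u) [NonUnitalCStarAlgebra A] where
  /-- the endomorphism -/
  α : A →⋆ₙₐ[ℂ] A
  /-- `α` is extendible: it extends to a strictly continuous (not necessarily unital) endomorphism
  of the multiplier algebra -/
  extendible : ∃ αbar : 𝓜(ℂ, A) →⋆ₙₐ[ℂ] 𝓜(ℂ, A),
    @Continuous _ _ (strictTopology A) (strictTopology A) αbar ∧
      ∀ a : A, αbar (a : 𝓜(ℂ, A)) = (α a : 𝓜(ℂ, A))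
  /-- the transfer operator, a bounded linear map -/
  L : A →L[ℂ] A
  L_nonneg : ∀ a : A, 0 ≤ a → 0 ≤ L a
  /-- `L` extends to a bounded positive linear map `Lbar` on the multiplier algebra, and
  `L (α(a) m) = a Lbar(m)` -/
  exists_extension : ∃ Lbar : 𝓜(ℂ, A) →L[ℂ] 𝓜(ℂ, A),
    (∀ m : 𝓜(ℂ, A), 0 ≤ m → 0 ≤ Lbar m) ∧
      (∀ a : A, Lbar (a : 𝓜(ℂ, A)) = (L a : 𝓜(ℂ, A))) ∧
        ∀ (a : A) (m : 𝓜(ℂ, A)), L (m.snd (α a)) = (Lbar m).snd a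

/-! ### Hilbert bimodules -/

/-- A Hilbert `A`-bimodule structure (correspondence over `A`) on a Banach space `M`: a right Hilbert
`A`-module, with right action `x · a = rsmul x a`, and an `A`-valued inner product conjugate linear
in the first variable and `A`-linear in the second, inducing the norm of `M`, together with a left
action `a · x = φ a x` given by a `⋆`-homomorphism `φ` of `A` into the adjointable operators.
(Mathlib's `CStarModule` has the algebra acting on the left of the inner product.) -/
structure HilbertBimodule (A : Type u) [NonUnitalCStarAlgebra A] (M : Type v)
    [NormedAddCommGroup M] [NormedSpace ℂ M] [CompleteSpace M] where
  rsmul : M → A → M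
  add_rsmul : ∀ x y a, rsmul (x + y) a = rsmul x a + rsmul y a
  smul_rsmul : ∀ (z : ℂ) x a, rsmul (z • x) a = z • rsmul x a
  rsmul_add : ∀ x a b, rsmul x (a + b) = rsmul x a + rsmul x b
  rsmul_smul : ∀ (z : ℂ) x a, rsmul x (z • a) = z • rsmul x a
  rsmul_mul : ∀ x a b, rsmul x (a * b) = rsmul (rsmul x a) b
  inner : M → M → A
  inner_add_right : ∀ x y z, inner x (y + z) = inner x y + inner x z
  inner_smul_right : ∀ (c : ℂ) x y, inner x (c • y) = c • inner x y
  inner_rsmul_right : ∀ x y a, inner x (rsmul y a) = inner x y * a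
  star_inner : ∀ x y, star (inner x y) = inner y x
  inner_self_nonneg : ∀ x, 0 ≤ inner x x
  norm_sq_eq : ∀ x, ‖x‖ ^ 2 = ‖inner x x‖
  φ : A →ₙₐ[ℂ] (M →L[ℂ] M)
  inner_φ : ∀ a x y, inner (φ a x) y = inner x (φ (star a) y)

namespace ExelSystem

variable {A : Type u} [NonUnitalCStarAlgebra A] (X : ExelSystem A)

lemma L_α_mul (a b : A) : X.L (X.α a * b) = a * X.L b := by
  obtain ⟨Lbar, -, h2, h3⟩ := X.exists_extension
  have := h3 a b
  rw [h2] at this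
  simpa using this

lemma L_star (a : A) : X.L (star a) = star (X.L a) := by
  let f : A →ₚ[ℂ] A := PositiveLinearMap.mk₀ (X.L : A →ₗ[ℂ] A) X.L_nonneg
  exact map_star f a

lemma L_mul_α (b a : A) : X.L (b * X.α a) = X.L b * a := by
  have := X.L_α_mul (star a) (star b)
  have h := congrArg star this
  rw [← X.L_star, star_mul, star_star, map_star, star_star, star_mul, star_star, X.L_star,
    star_star] at h
  exact h

/-- The underlying space of the pre-inner-product module `A_L`: a copy of `A`. -/
def PreModule (_X : ExelSystem A) : Type u := A

instance : AddCommGroup X.PreModule := inferInstanceAs (AddCommGroup A)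
instance : Module ℂ X.PreModule := inferInstanceAs (Module ℂ A)

/-- The identity map from `A` to `A_L`. -/
def toPre : A ≃ₗ[ℂ] X.PreModule := LinearEquiv.refl ℂ _

/-- The pairing `⟨m, n⟩ = L (m⋆ n)` on `A_L`. -/
def preInner (m n : X.PreModule) : A := X.L (star (X.toPre.symm m) * X.toPre.symm n)

/-- The seminorm of `A_L` is `‖m‖ = ‖⟨m, m⟩‖ ^ (1/2)`. -/
instance : Norm X.PreModule := ⟨fun m => √‖X.preInner m m‖⟩

lemma pre_norm_sq (m : X.PreModule) : ‖m‖ ^ 2 = ‖X.preInner m m‖ :=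
  Real.sq_sqrt (norm_nonneg _)

lemma pre_norm_nonneg (m : X.PreModule) : 0 ≤ ‖m‖ := Real.sqrt_nonneg _

lemma preInner_self_nonneg (m : X.PreModule) : 0 ≤ X.preInner m m :=
  X.L_nonneg _ (star_mul_self_nonneg _)

lemma star_preInner (m n : X.PreModule) : star (X.preInner m n) = X.preInner n m := by
  simp [preInner, ← X.L_star]

lemma preInner_sq_le_aux (m n : X.PreModule) (c : ℝ) (hc : 0 < c) (h : ‖X.preInner m m‖ ≤ c) :
    ‖X.preInner m n‖ ^ 2 ≤ c * ‖X.preInner n n‖ := by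
  set x : A := X.toPre.symm m with hx
  set y : A := X.toPre.symm n with hy
  set s : A := X.L (star x * y) with hs
  have hs' : X.L (star y * x) = star s := by simp [hs, ← X.L_star]
  have hpos : 0 ≤ X.L (star (x * X.α s - c • y) * (x * X.α s - c • y)) :=
    X.L_nonneg _ (star_mul_self_nonneg _)
  have hexp : X.L (star (x * X.α s - c • y) * (x * X.α s - c • y))
      = star s * X.L (star x * x) * s - c • (star s * s) - c • (star s * s)
        + c • (c • X.L (star y * y)) := by
    have e : star (x * X.α s - c • y) * (x * X.α s - c • y)
        = X.α (star s) * (star x * x * X.α s) - c • (X.α (star s) * (star x * y))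
          - c • (star y * x * X.α s) + c • (c • (star y * y)) := by
      simp only [star_sub, star_mul, star_smul, sub_mul, mul_sub, smul_mul_assoc, mul_smul_comm,
        map_star, mul_assoc, star_trivial, smul_sub]
      abel
    have hr : ∀ (r : ℝ) (a : A), X.L (r • a) = r • X.L a := fun r a => by
      rw [← Complex.coe_smul, map_smul, Complex.coe_smul]
    rw [e]
    simp only [map_sub, map_add, hr, L_α_mul, L_mul_α, hs', ← hs]
    simp only [mul_assoc]
  have hbd : star s * X.L (star x * x) * s ≤ c • (star s * s) := by
    refine (CStarAlgebra.star_left_conjugate_le_norm_smul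
      (hb := .of_nonneg (X.preInner_self_nonneg m))).trans ?_
    exact smul_le_smul_of_nonneg_right h (star_mul_self_nonneg s)
  have h1 : 0 ≤ c • (c • X.L (star y * y) - star s * s) := by
    calc 0 ≤ _ := hpos
      _ = _ := hexp
      _ ≤ c • (star s * s) - c • (star s * s) - c • (star s * s)
        + c • (c • X.L (star y * y)) := by gcongr
      _ = _ := by rw [smul_sub]; abel
  have h2 : star s * s ≤ c • X.L (star y * y) := by
    rw [← sub_nonneg]
    have := smul_nonneg (inv_nonneg.2 hc.le) h1
    rwa [smul_smul, inv_mul_cancel₀ hc.ne', one_smul] at this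
  calc ‖X.preInner m n‖ ^ 2 = ‖star s * s‖ := by rw [CStarRing.norm_star_mul_self, sq]; rfl
    _ ≤ ‖c • X.L (star y * y)‖ :=
      CStarAlgebra.norm_le_norm_of_nonneg_of_le (star_mul_self_nonneg s) h2
    _ = c * ‖X.preInner n n‖ := by rw [norm_smul, Real.norm_of_nonneg hc.le]; rfl

/-- Cauchy--Schwarz inequality in `A_L`. -/
lemma norm_preInner_le (m n : X.PreModule) : ‖X.preInner m n‖ ≤ ‖m‖ * ‖n‖ := by
  rw [← sq_le_sq₀ (norm_nonneg _) (mul_nonneg (X.pre_norm_nonneg m) (X.pre_norm_nonneg n)),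
    mul_pow, X.pre_norm_sq, X.pre_norm_sq]
  have : ∀ ε : ℝ, 0 < ε → ‖X.preInner m n‖ ^ 2 ≤
      ‖X.preInner m m‖ * ‖X.preInner n n‖ + ε * ‖X.preInner n n‖ := fun ε hε => by
    rw [← add_mul]
    exact X.preInner_sq_le_aux m n _ (by positivity) (by linarith)
  refine ge_of_tendsto (f := fun ε : ℝ => ‖X.preInner m m‖ * ‖X.preInner n n‖
    + ε * ‖X.preInner n n‖) (x := nhdsWithin 0 (Set.Ioi 0)) ?_
    (Filter.eventually_of_mem self_mem_nhdsWithin this)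
  have hcont : Continuous fun ε : ℝ => ‖X.preInner m m‖ * ‖X.preInner n n‖
    + ε * ‖X.preInner n n‖ := by fun_prop
  simpa using (hcont.tendsto 0).mono_left nhdsWithin_le_nhds

lemma preInner_add_right (x y z : X.PreModule) :
    X.preInner x (y + z) = X.preInner x y + X.preInner x z := by
  simp [preInner, mul_add]

lemma preInner_add_left (x y z : X.PreModule) :
    X.preInner (x + y) z = X.preInner x z + X.preInner y z := by
  simp [preInner, add_mul]

lemma preInner_smul_right (c : ℂ) (x y : X.PreModule) :
    X.preInner x (c • y) = c • X.preInner x y := by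
  simp [preInner, mul_smul_comm]

lemma preInner_smul_left (c : ℂ) (x y : X.PreModule) :
    X.preInner (c • x) y = star c • X.preInner x y := by
  simp [preInner, smul_mul_assoc]

lemma preCore : SeminormedSpace.Core ℂ X.PreModule where
  norm_nonneg := X.pre_norm_nonneg
  norm_smul c x := by
    rw [← sq_eq_sq₀ (X.pre_norm_nonneg _) (mul_nonneg (norm_nonneg _) (X.pre_norm_nonneg _)),
      mul_pow, X.pre_norm_sq, X.pre_norm_sq, preInner_smul_left, preInner_smul_right, norm_smul,
      norm_smul, norm_star]
    ring
  norm_triangle x y := by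
    rw [← sq_le_sq₀ (X.pre_norm_nonneg _) (add_nonneg (X.pre_norm_nonneg _) (X.pre_norm_nonneg _)),
      X.pre_norm_sq, preInner_add_left, preInner_add_right, preInner_add_right]
    have h1 := norm_add_le (X.preInner x x + X.preInner x y) (X.preInner y x + X.preInner y y)
    have h2 := norm_add_le (X.preInner x x) (X.preInner x y)
    have h3 := norm_add_le (X.preInner y x) (X.preInner y y)
    have h4 := X.norm_preInner_le x y
    have h5 := X.norm_preInner_le y x
    have h6 := X.pre_norm_sq x
    have h7 := X.pre_norm_sq y
    nlinarith

instance : SeminormedAddCommGroup X.PreModule := SeminormedAddCommGroup.ofCore X.preCore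
instance : NormedSpace ℂ X.PreModule where
  norm_smul_le c x := (X.preCore.norm_smul c x).le

/-- The Hilbert module `M_L`: the (Hausdorff) completion of `A_L`. -/
abbrev ML : Type u := UniformSpace.Completion X.PreModule

/-- The canonical map `q : A_L → M_L`. -/
def q : A →ₗ[ℂ] X.ML :=
  (UniformSpace.Completion.toComplL (𝕜 := ℂ) (E := X.PreModule)).toLinearMap ∘ₗ
    X.toPre.toLinearMap

/-- The pairing of `A_L` as a bounded sesquilinear map. -/
def preInnerL : X.PreModule →L⋆[ℂ] X.PreModule →L[ℂ] A :=
  LinearMap.mkContinuous₂ (LinearMap.mk₂'ₛₗ (starRingEnd ℂ) (RingHom.id ℂ) X.preInner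
    X.preInner_add_left X.preInner_smul_left X.preInner_add_right X.preInner_smul_right) 1
    (fun m n => by simpa using X.norm_preInner_le m n)

/-- The right action `m · a = m α(a)` on `A_L`, as a bounded bilinear map. -/
def preRight : X.PreModule →L[ℂ] A →L[ℂ] X.PreModule :=
  LinearMap.mkContinuous₂ (LinearMap.mk₂ ℂ
    (fun (m : X.PreModule) (a : A) => X.toPre (X.toPre.symm m * X.α a))
    (fun m n a => by simp [add_mul]) (fun c m a => by simp [smul_mul_assoc])
    (fun m a b => by simp [mul_add]) (fun c m a => by simp [mul_smul_comm])) 1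
    (fun m a => by
      rw [one_mul, ← sq_le_sq₀ (norm_nonneg _) (by positivity), mul_pow, X.pre_norm_sq,
        X.pre_norm_sq]
      have : X.preInner (X.toPre (X.toPre.symm m * X.α a)) (X.toPre (X.toPre.symm m * X.α a))
          = star a * X.preInner m m * a := by
        have e : star (X.toPre.symm m * X.α a) * (X.toPre.symm m * X.α a)
            = X.α (star a) * (star (X.toPre.symm m) * X.toPre.symm m * X.α a) := by
          simp only [star_mul, map_star, mul_assoc]
        simp only [preInner, LinearEquiv.symm_apply_apply]
        rw [e, L_α_mul, L_mul_α, mul_assoc]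
      simp only [LinearMap.mk₂_apply]
      rw [this]
      calc ‖star a * X.preInner m m * a‖ ≤ ‖star a‖ * ‖X.preInner m m‖ * ‖a‖ := by
            grw [norm_mul_le, norm_mul_le]
        _ = ‖X.preInner m m‖ * ‖a‖ ^ 2 := by rw [norm_star]; ring)

/-- The left action `a · m = a m` on `A_L`, as a bounded bilinear map. -/
def preLeft : A →L[ℂ] X.PreModule →L[ℂ] X.PreModule :=
  LinearMap.mkContinuous₂ (LinearMap.mk₂ ℂ
    (fun (a : A) (m : X.PreModule) => X.toPre (a * X.toPre.symm m))
    (fun m n a => by simp [add_mul]) (fun c m a => by simp [smul_mul_assoc])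
    (fun m a b => by simp [mul_add]) (fun c m a => by simp [mul_smul_comm])) 1
    (fun a m => by
      rw [one_mul, ← sq_le_sq₀ (norm_nonneg _) (by positivity), mul_pow, X.pre_norm_sq,
        X.pre_norm_sq]
      set x : A := X.toPre.symm m with hx
      have h0 : star (a * x) * (a * x) ≤ ‖a‖ ^ 2 • (star x * x) := by
        have := CStarAlgebra.star_left_conjugate_le_norm_smul (a := x) (b := star a * a)
        rw [CStarRing.norm_star_mul_self, ← sq] at this
        simpa only [star_mul, mul_assoc] using this
      have h1 : X.L (star (a * x) * (a * x)) ≤ ‖a‖ ^ 2 • X.L (star x * x) := by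
        have := X.L_nonneg _ (sub_nonneg.2 h0)
        rwa [map_sub, ← Complex.coe_smul, map_smul, Complex.coe_smul, sub_nonneg] at this
      have h2 := CStarAlgebra.norm_le_norm_of_nonneg_of_le
        (X.L_nonneg _ (star_mul_self_nonneg (a * x))) h1
      rw [norm_smul, Real.norm_of_nonneg (by positivity)] at h2
      exact h2)

/-- The inner product of `M_L`: the continuous extension of the pairing of `A_L`. -/
def innerML : X.ML →L⋆[ℂ] X.ML →L[ℂ] A :=
  X.preInnerL.fromCompletion.flip.fromCompletion.flip

/-- The right action of `A` on `M_L`: the continuous extension of the right action on `A_L`. -/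
def rightML : X.ML →L[ℂ] A →L[ℂ] X.ML :=
  ((ContinuousLinearMap.compL ℂ A X.PreModule X.ML UniformSpace.Completion.toComplL) ∘L
    X.preRight).fromCompletion

/-- The left action of `A` on `M_L`: the continuous extension of the left action on `A_L`. -/
def leftML : A →L[ℂ] X.ML →L[ℂ] X.ML :=
  (((ContinuousLinearMap.compL ℂ X.PreModule X.PreModule X.ML UniformSpace.Completion.toComplL) ∘L
    X.preLeft).flip.fromCompletion).flip

lemma innerML_q (m n : A) : X.innerML (X.q m) (X.q n) = X.L (star m * n) := by
  simp [innerML, q, preInnerL, preInner]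

lemma rightML_q (m a : A) : X.rightML (X.q m) a = X.q (m * X.α a) := by
  simp [rightML, q, preRight]

lemma leftML_q (a m : A) : X.leftML a (X.q m) = X.q (a * m) := by
  simp [leftML, q, preLeft]

lemma norm_sq_q (m : A) : ‖X.q m‖ ^ 2 = ‖X.L (star m * m)‖ := by
  simp [q, pre_norm_sq, preInner]

lemma denseRange_q : DenseRange X.q :=
  UniformSpace.Completion.denseRange_coe.comp X.toPre.surjective.denseRange
    (UniformSpace.Completion.continuous_coe _)

/-- The Hilbert `A`-bimodule `M_L`. -/
def bimodule : HilbertBimodule A X.ML where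
  rsmul x a := X.rightML x a
  add_rsmul x y a := by simp
  smul_rsmul z x a := by simp
  rsmul_add x a b := by simp
  rsmul_smul z x a := by simp
  rsmul_mul x a b := by
    refine X.denseRange_q.induction_on x (isClosed_eq (by fun_prop) (by fun_prop)) fun m => ?_
    simp [rightML_q, mul_assoc]
  inner x y := X.innerML x y
  inner_add_right x y z := by simp
  inner_smul_right c x y := by simp
  inner_rsmul_right x y a := by
    refine X.denseRange_q.induction_on₂ (isClosed_eq (by fun_prop) (by fun_prop)) (fun m n => ?_) x y
    simp [rightML_q, innerML_q, ← L_mul_α, mul_assoc]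
  star_inner x y := by
    refine X.denseRange_q.induction_on₂ (isClosed_eq (by fun_prop) (by fun_prop)) (fun m n => ?_) x y
    simp [innerML_q, ← L_star]
  inner_self_nonneg x := by
    refine X.denseRange_q.induction_on x (isClosed_le (by fun_prop) (by fun_prop)) fun m => ?_
    rw [innerML_q]
    exact X.L_nonneg _ (star_mul_self_nonneg m)
  norm_sq_eq x := by
    refine X.denseRange_q.induction_on x (isClosed_eq (by fun_prop) (by fun_prop)) fun m => ?_
    rw [innerML_q, norm_sq_q]
  φ :=
    { toFun := fun a => X.leftML a
      map_smul' := fun z a => by simp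
      map_zero' := by simp
      map_add' := fun a b => by simp
      map_mul' := fun a b => by
        ext x
        refine X.denseRange_q.induction_on x (isClosed_eq (by fun_prop) (by fun_prop)) fun m => ?_
        simp [leftML_q, mul_assoc] }
  inner_φ a x y := by
    refine X.denseRange_q.induction_on₂ (isClosed_eq (by fun_prop) (by fun_prop)) (fun m n => ?_) x y
    simp [leftML_q, innerML_q, mul_assoc]

end ExelSystem

/-! ### Toeplitz representations and the Toeplitz algebra of a Hilbert bimodule -/

section Toeplitz

variable {A : Type u} [NonUnitalCStarAlgebra A] {M : Type v} [NormedAddCommGroup M]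
  [NormedSpace ℂ M] [CompleteSpace M]

/-- `(ψ, π)` is a Toeplitz representation of the Hilbert bimodule `M` in the `C⋆`-algebra `B`. -/
structure IsToeplitzRep (H : HilbertBimodule A M) {B : Type*} [NonUnitalCStarAlgebra B]
    (ψ : M →ₗ[ℂ] B) (π : A →⋆ₙₐ[ℂ] B) : Prop where
  map_rsmul : ∀ x a, ψ (H.rsmul x a) = ψ x * π a
  star_mul_map : ∀ x y, star (ψ x) * ψ y = π (H.inner x y)
  map_φ : ∀ a x, ψ (H.φ a x) = π a * ψ x

end Toeplitz

/-- `(T, i_M, i_A)` is a Toeplitz algebra `𝒯(M)` of the Hilbert bimodule `M`: `(i_M, i_A)` is a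
universal Toeplitz representation, and `T` is generated by it as a `C⋆`-algebra. -/
structure IsToeplitzAlgebra {A M : Type u} [NonUnitalCStarAlgebra A] [NormedAddCommGroup M]
    [NormedSpace ℂ M] [CompleteSpace M] (H : HilbertBimodule A M)
    {T : Type u} [NonUnitalCStarAlgebra T] (iM : M →ₗ[ℂ] T) (iA : A →⋆ₙₐ[ℂ] T) : Prop where
  isToeplitzRep : IsToeplitzRep H iM iA
  generates : (NonUnitalStarAlgebra.adjoin ℂ (Set.range iM ∪ Set.range iA)).topologicalClosure = ⊤
  universal : ∀ (B : Type u) [NonUnitalCStarAlgebra B] (ψ : M →ₗ[ℂ] B) (π : A →⋆ₙₐ[ℂ] B),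
    IsToeplitzRep H ψ π →
      ∃ Φ : T →⋆ₙₐ[ℂ] B, (∀ x, Φ (iM x) = ψ x) ∧ (∀ a, Φ (iA a) = π a)

/-! ### Toeplitz-covariant representations and the Toeplitz crossed product -/

/-- `(π, V)` is a Toeplitz-covariant representation of the Exel system in the `C⋆`-algebra `B`:
`π` is nondegenerate, `V` is a multiplier of `B`, and (TC1), (TC2) hold. -/
structure IsToeplitzCovariantRep {A : Type u} [NonUnitalCStarAlgebra A] (X : ExelSystem A)
    {B : Type*} [NonUnitalCStarAlgebra B] (π : A →⋆ₙₐ[ℂ] B) (V : 𝓜(ℂ, B)) : Prop where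
  nondegenerate : IsNondegenerate π
  mul_map : ∀ a, V * (π a : 𝓜(ℂ, B)) = (π (X.α a) : 𝓜(ℂ, B)) * V
  star_mul_map_mul : ∀ a, star V * (π a : 𝓜(ℂ, B)) * V = (π (X.L a) : 𝓜(ℂ, B))

/-- `(T, i, S)` is a Toeplitz crossed product `𝒯(A, α, L)`: `(i, S)` is a universal
Toeplitz-covariant representation, and `T` is generated by it as a `C⋆`-algebra, that is, by
the elements `i(a)` and `i(a) S` of `T`.  In the universal property, `Φ` is automatically
nondegenerate because `π` is, so that it extends to multipliers. -/
structure IsToeplitzCrossedProduct {A : Type u} [NonUnitalCStarAlgebra A] (X : ExelSystem A)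
    {T : Type u} [NonUnitalCStarAlgebra T] (i : A →⋆ₙₐ[ℂ] T) (S : 𝓜(ℂ, T)) : Prop where
  isToeplitzCovariantRep : IsToeplitzCovariantRep X i S
  generates : (NonUnitalStarAlgebra.adjoin ℂ
    (Set.range i ∪ Set.range fun a : A => S.snd (i a))).topologicalClosure = ⊤
  universal : ∀ (B : Type u) [NonUnitalCStarAlgebra B] (π : A →⋆ₙₐ[ℂ] B) (V : 𝓜(ℂ, B)),
    IsToeplitzCovariantRep X π V →
      ∃ Φ : T →⋆ₙₐ[ℂ] B, (∀ a, Φ (i a) = π a) ∧ ExtensionMapsTo Φ S V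

end

/-! Toeplitz representations `(ψ, π)` of `X.ML` with `π` nondegenerate are the same thing as
Toeplitz-covariant representations `(π, V)`, the dictionary being `ψ (q a) = π(a) V`. Given `(π,
V)`, the relation `V⋆ π(a) V = π(L a)` makes `a ↦ π(a) V` preserve inner products, so it extends to
the completion, and `V π(a) = π(α a) V` makes it a right module map
(`IsToeplitzCovariantRep.exists_isToeplitzRep`). Given `(ψ, π)`, let `u` run through an approximate
unit of `A`. Then `ψ(q u) π(a) = ψ(q (u α(a)))` and `π(a) ψ(q u) = ψ(q (a u))` converge, so `ψ(q u)`
converges strictly to a multiplier `V` (`IsToeplitzRep.exists_isToeplitzCovariantRep`).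

The one mismatch is that Toeplitz representations need not be nondegenerate. In an algebra generated
by such a representation, however, `π` is automatically nondegenerate
(`IsToeplitzRep.isNondegenerate`). Hence the Toeplitz algebra of `X.ML` is itself a Toeplitz crossed
product, and the two universal properties supply mutually inverse homomorphisms. The Toeplitz
algebra exists by a general construction inside an `ℓ^∞`-product (`exists_universal_cstarAlgebra`).
-/

/-! ### Universal `C⋆`-algebras -/

/-- Formal noncommutative `⋆`-polynomials without constant term in the variables `G`. -/
inductive StarExpr (G : Type u) : Type u
  | of (x : G) : StarExpr G
  | zero : StarExpr G
  | add (v w : StarExpr G) : StarExpr G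
  | smul (c : ℂ) (w : StarExpr G) : StarExpr G
  | mul (v w : StarExpr G) : StarExpr G
  | star (w : StarExpr G) : StarExpr G

namespace StarExpr

variable {G : Type u} {B : Type*} [NonUnitalCStarAlgebra B] {C : Type*} [NonUnitalCStarAlgebra C]

/-- The value of a `⋆`-polynomial at a family of elements of a `C⋆`-algebra. -/
def eval (f : G → B) : StarExpr G → B
  | of x => f x
  | zero => 0
  | add v w => v.eval f + w.eval f
  | smul c w => c • w.eval f
  | mul v w => v.eval f * w.eval f
  | star w => Star.star (w.eval f)

lemma map_eval (ρ : B →⋆ₙₐ[ℂ] C) (f : G → B) (w : StarExpr G) :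
    ρ (w.eval f) = w.eval (fun x => ρ (f x)) := by
  induction w with
  | of x => rfl
  | zero => exact map_zero ρ
  | add v w hv hw => simp [eval, hv, hw]
  | smul c w hw => simp [eval, hw]
  | mul v w hv hw => simp [eval, hv, hw]
  | star w hw => simp [eval, hw, map_star]

lemma exists_eval_eq (f : G → B) {b : B} (hb : b ∈ NonUnitalStarAlgebra.adjoin ℂ (Set.range f)) :
    ∃ w : StarExpr G, w.eval f = b := by
  induction hb using NonUnitalStarAlgebra.adjoin_induction with
  | mem x hx => obtain ⟨y, rfl⟩ := hx; exact ⟨of y, rfl⟩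
  | add x y _ _ hx hy =>
    obtain ⟨v, rfl⟩ := hx
    obtain ⟨w, rfl⟩ := hy
    exact ⟨add v w, rfl⟩
  | zero => exact ⟨zero, rfl⟩
  | mul x y _ _ hx hy =>
    obtain ⟨v, rfl⟩ := hx
    obtain ⟨w, rfl⟩ := hy
    exact ⟨mul v w, rfl⟩
  | smul c x _ hx =>
    obtain ⟨w, rfl⟩ := hx
    exact ⟨smul c w, rfl⟩
  | star x _ hx =>
    obtain ⟨w, rfl⟩ := hx
    exact ⟨star w, rfl⟩

end StarExpr

/-! ### Algebras and homomorphisms determined by generators. -/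

section Generation

variable {B : Type*} [NonUnitalCStarAlgebra B] {C : Type*} [NonUnitalCStarAlgebra C]

lemma mem_of_topologicalClosure_adjoin_eq_top {s : Set B}
    (hs : (NonUnitalStarAlgebra.adjoin ℂ s).topologicalClosure = ⊤)
    (K : NonUnitalStarSubalgebra ℂ B) (hK : IsClosed (K : Set B)) (h : s ⊆ K) (b : B) : b ∈ K := by
  have h1 := NonUnitalStarSubalgebra.topologicalClosure_minimal _
    (NonUnitalStarAlgebra.adjoin_le h) hK
  rw [hs] at h1
  exact h1 trivial

lemma NonUnitalStarAlgHom.ext_of_topologicalClosure_adjoin_eq_top {s : Set B}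
    (hs : (NonUnitalStarAlgebra.adjoin ℂ s).topologicalClosure = ⊤)
    {f g : B →⋆ₙₐ[ℂ] C} (h : ∀ x ∈ s, f x = g x) (b : B) : f b = g b :=
  mem_of_topologicalClosure_adjoin_eq_top hs (NonUnitalStarAlgHom.equalizer f g)
    (isClosed_eq (map_continuous f) (map_continuous g)) h b

noncomputable instance NonUnitalStarSubalgebra.nonUnitalCStarAlgebraTopologicalClosure
    (D : NonUnitalStarSubalgebra ℂ B) : NonUnitalCStarAlgebra D.topologicalClosure :=
  NonUnitalStarSubalgebra.nonUnitalCStarAlgebra D.topologicalClosure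
    (h_closed := D.isClosed_topologicalClosure)

/-- Closures in a subspace are traces of ambient closures, so a generated closed subalgebra is still
generated by the same elements when viewed as an algebra of its own. -/
lemma topologicalClosure_adjoin_preimage_eq_top (s : Set B) :
    (NonUnitalStarAlgebra.adjoin ℂ
      {x : (NonUnitalStarAlgebra.adjoin ℂ s).topologicalClosure | (x : B) ∈ s}).topologicalClosure
      = ⊤ := by
  set D := NonUnitalStarAlgebra.adjoin ℂ s
  set E := NonUnitalStarAlgebra.adjoin ℂ {x : D.topologicalClosure | (x : B) ∈ s}
  rw [eq_top_iff]
  rintro ⟨x, hx⟩ -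
  have hle : D ≤ E.map (NonUnitalStarSubalgebraClass.subtype D.topologicalClosure) :=
    NonUnitalStarAlgebra.adjoin_le fun y hy => by
      have hyD : y ∈ D.topologicalClosure :=
        D.le_topologicalClosure (NonUnitalStarAlgebra.subset_adjoin ℂ s hy)
      exact ⟨⟨y, hyD⟩, NonUnitalStarAlgebra.subset_adjoin ℂ _ hy, rfl⟩
  have hx' : x ∈ closure (D : Set B) := hx
  change (⟨x, hx⟩ : D.topologicalClosure) ∈ closure (E : Set D.topologicalClosure)
  rw [closure_subtype]
  exact closure_mono hle hx'

/-- A `⋆`-homomorphism can be defined on the generators of a `C⋆`-algebra, provided that it does not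
increase the norms of the `⋆`-polynomials in them. -/
lemma exists_nonUnitalStarAlgHom_of_norm_eval_le {G : Type u} (g : G → B)
    (hg : (NonUnitalStarAlgebra.adjoin ℂ (Set.range g)).topologicalClosure = ⊤) (f : G → C)
    (h : ∀ w : StarExpr G, ‖w.eval f‖ ≤ ‖w.eval g‖) :
    ∃ Φ : B →⋆ₙₐ[ℂ] C, ∀ x, Φ (g x) = f x := by
  -- `Φ` is recovered from its graph, the closed subalgebra of `B × C` generated by the pairs `(g x,
  -- f x)`. The hypothesis makes the first projection isometric, hence injective with closed range.
  -- The range contains the generators, so it is everything, and `Φ` is the second projection after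
  -- the inverse of the first.
  let k : G → B × C := fun x => (g x, f x)
  let D := NonUnitalStarAlgebra.adjoin ℂ (Set.range k)
  let ι := NonUnitalStarSubalgebraClass.subtype D.topologicalClosure
  let p : D.topologicalClosure →⋆ₙₐ[ℂ] B := (NonUnitalStarAlgHom.fst ℂ B C).comp ι
  let r : D.topologicalClosure →⋆ₙₐ[ℂ] C := (NonUnitalStarAlgHom.snd ℂ B C).comp ι
  have hle : ∀ y : D.topologicalClosure, ‖r y‖ ≤ ‖p y‖ := by
    rintro ⟨y, hy⟩
    change ‖y.2‖ ≤ ‖y.1‖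
    refine closure_minimal (t := {y : B × C | ‖y.2‖ ≤ ‖y.1‖}) (fun z hz => ?_)
      (isClosed_le (by fun_prop) (by fun_prop)) hy
    obtain ⟨w, rfl⟩ := StarExpr.exists_eval_eq k hz
    have h1 := StarExpr.map_eval (NonUnitalStarAlgHom.fst ℂ B C) k w
    have h2 := StarExpr.map_eval (NonUnitalStarAlgHom.snd ℂ B C) k w
    simp only [NonUnitalStarAlgHom.fst_apply, NonUnitalStarAlgHom.snd_apply, k] at h1 h2
    simp only [Set.mem_ofPred_eq]
    rw [h1, h2]
    exact h w
  have hiso : Isometry p := by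
    refine AddMonoidHomClass.isometry_of_norm p fun y => ?_
    change ‖p y‖ = max ‖p y‖ ‖r y‖
    rw [max_eq_left (hle y)]
  have hsurj : Function.Surjective p := fun b => by
    refine mem_of_topologicalClosure_adjoin_eq_top hg (NonUnitalStarAlgHom.range p) ?_ ?_ b
    · exact hiso.isClosedEmbedding.isClosed_range
    · rintro _ ⟨x, rfl⟩
      exact ⟨⟨k x, D.le_topologicalClosure (NonUnitalStarAlgebra.subset_adjoin ℂ _ ⟨x, rfl⟩)⟩, rfl⟩
  let e := StarAlgEquiv.ofBijective p ⟨hiso.injective, hsurj⟩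
  refine ⟨r.comp (e.symm : B →⋆ₙₐ[ℂ] D.topologicalClosure), fun x => ?_⟩
  have hx : e.symm (g x)
      = ⟨k x, D.le_topologicalClosure (NonUnitalStarAlgebra.subset_adjoin ℂ _ ⟨x, rfl⟩)⟩ :=
    e.symm_apply_eq.2 rfl
  change r (e.symm (g x)) = f x
  rw [hx]
  rfl

end Generation

/-- The coordinate projections of an `ℓ^∞`-product of `C⋆`-algebras. -/
def lpInftyEval {ι : Type*} (B : ι → Type*) [∀ i, NonUnitalCStarAlgebra (B i)] (i : ι) :
    lp B ⊤ →⋆ₙₐ[ℂ] B i where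
  toFun f := f i
  map_smul' _ _ := rfl
  map_zero' := rfl
  map_add' _ _ := rfl
  map_mul' _ _ := rfl
  map_star' _ := rfl

/-- Existence of universal `C⋆`-algebras: `P` is a property of families of elements of
`C⋆`-algebras which bounds the norms of the elements, and which can be tested on a jointly faithful
family of homomorphisms. -/
theorem exists_universal_cstarAlgebra {G : Type u}
    (P : ∀ (B : Type u) [NonUnitalCStarAlgebra B], (G → B) → Prop) (c : G → ℝ)
    (hc : ∀ (B : Type u) [NonUnitalCStarAlgebra B] (f : G → B), P B f → ∀ x, ‖f x‖ ≤ c x)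
    (hP : ∀ (C : Type u) [NonUnitalCStarAlgebra C] (g : G → C) (ι : Type u) (B : ι → Type u)
      [∀ i, NonUnitalCStarAlgebra (B i)] (ρ : ∀ i, C →⋆ₙₐ[ℂ] B i),
      (∀ x y, (∀ i, ρ i x = ρ i y) → x = y) → (∀ i, P (B i) fun x => ρ i (g x)) → P C g) :
    ∃ (T : Type u) (_ : NonUnitalCStarAlgebra T) (g : G → T), P T g ∧
      (NonUnitalStarAlgebra.adjoin ℂ (Set.range g)).topologicalClosure = ⊤ ∧
      ∀ (B : Type u) [NonUnitalCStarAlgebra B] (f : G → B), P B f →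
        ∃ Φ : T →⋆ₙₐ[ℂ] B, ∀ x, Φ (g x) = f x := by
  -- All pairs `(B, f)` satisfying `P` are too many to index a product in `Type u`. Only the norms
  -- of `⋆`-polynomials matter, and these are functions `StarExpr G → ℝ`, so one representative is
  -- chosen for each norm function that occurs.
  let I : Type u := {n : StarExpr G → ℝ // ∃ (B : Type u) (_ : NonUnitalCStarAlgebra B) (f : G → B),
    P B f ∧ ∀ w : StarExpr G, ‖w.eval f‖ = n w}
  let B : I → Type u := fun n => n.2.choose
  let _ : ∀ n, NonUnitalCStarAlgebra (B n) := fun n => n.2.choose_spec.choose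
  let f : ∀ n, G → B n := fun n => n.2.choose_spec.choose_spec.choose
  have hf : ∀ n, P (B n) (f n) := fun n => n.2.choose_spec.choose_spec.choose_spec.1
  have hnorm : ∀ n (w : StarExpr G), ‖w.eval (f n)‖ = n.1 w :=
    fun n => n.2.choose_spec.choose_spec.choose_spec.2
  let F : G → lp B ⊤ := fun x => ⟨fun n => f n x, memℓp_infty ⟨c x, by
    rintro _ ⟨n, rfl⟩
    exact hc _ _ (hf n) x⟩⟩
  let D := NonUnitalStarAlgebra.adjoin ℂ (Set.range F)
  let g : G → D.topologicalClosure := fun x =>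
    ⟨F x, D.le_topologicalClosure (NonUnitalStarAlgebra.subset_adjoin ℂ _ ⟨x, rfl⟩)⟩
  let ρ : ∀ n, D.topologicalClosure →⋆ₙₐ[ℂ] B n := fun n =>
    (lpInftyEval B n).comp (NonUnitalStarSubalgebraClass.subtype D.topologicalClosure)
  have hg : (NonUnitalStarAlgebra.adjoin ℂ (Set.range g)).topologicalClosure = ⊤ := by
    convert topologicalClosure_adjoin_preimage_eq_top (Set.range F) using 3
    ext y
    exact ⟨fun ⟨x, hx⟩ => ⟨x, congrArg Subtype.val hx⟩, fun ⟨x, hx⟩ => ⟨x, Subtype.ext hx⟩⟩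
  refine ⟨D.topologicalClosure, inferInstance, g, ?_, hg, ?_⟩
  · refine hP _ g I B ρ (fun x y h => Subtype.ext (lp.ext (funext h))) hf
  · intro C _ k hk
    refine exists_nonUnitalStarAlgHom_of_norm_eval_le g hg k fun w => ?_
    -- The given `k` has the same polynomial norms as one chosen coordinate, and a coordinate
    -- projection does not increase norms.
    let n : I := ⟨fun w => ‖w.eval k‖, C, inferInstance, k, hk, fun _ => rfl⟩
    calc ‖w.eval k‖ = ‖w.eval (f n)‖ := (hnorm n w).symm
      _ = ‖ρ n (w.eval g)‖ := by rw [StarExpr.map_eval]; rfl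
      _ ≤ ‖w.eval g‖ := NonUnitalStarAlgHom.norm_apply_le (ρ n) _

/-! ### Strict limits and multipliers -/

section Limits

open Filter Topology

lemma isClosed_setOf_tendsto_zero {ι E E' : Type*} [SeminormedAddCommGroup E]
    [SeminormedAddCommGroup E'] {l : Filter ι} (F : ι → E → E') (K : ℝ)
    (hF : ∀ᶠ u in l, ∀ x y, ‖F u x - F u y‖ ≤ K * ‖x - y‖) :
    IsClosed {x | Tendsto (fun u => F u x) l (𝓝 0)} := by
  refine isClosed_of_closure_subset fun x hx => ?_
  rw [Set.mem_ofPred_eq, Metric.tendsto_nhds]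
  intro ε hε
  -- This radius forces `K * ‖x - y‖ < ε / 2`; `|K| + 1` keeps it positive without a sign assumption
  -- on `K`.
  obtain ⟨y, hy, hxy⟩ := Metric.mem_closure_iff.1 hx (ε / (2 * (|K| + 1))) (by positivity)
  rw [Set.mem_ofPred_eq, Metric.tendsto_nhds] at hy
  filter_upwards [hy (ε / 2) (by positivity), hF] with u hu hFu
  rw [dist_zero_right] at hu ⊢
  rw [dist_eq_norm, lt_div_iff₀ (by positivity)] at hxy
  have h1 := hFu x y
  have h2 : ‖F u x‖ ≤ ‖F u x - F u y‖ + ‖F u y‖ := by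
    simpa using norm_add_le (F u x - F u y) (F u y)
  have h3 : K * ‖x - y‖ ≤ (|K| + 1) * ‖x - y‖ := by
    gcongr
    linarith [le_abs_self K]
  linarith

/-- By completeness, convergence means that `F u x - F v x` tends to `0` along `l ×ˢ l`, and these
differences have Lipschitz constant `K + K`. -/
lemma isClosed_setOf_exists_tendsto {ι E E' : Type*} [SeminormedAddCommGroup E]
    [SeminormedAddCommGroup E'] [CompleteSpace E'] {l : Filter ι} [l.NeBot] (F : ι → E → E')
    (K : ℝ) (hF : ∀ᶠ u in l, ∀ x y, ‖F u x - F u y‖ ≤ K * ‖x - y‖) :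
    IsClosed {x | ∃ z, Tendsto (fun u => F u x) l (𝓝 z)} := by
  have h : ∀ x, (∃ z, Tendsto (fun u => F u x) l (𝓝 z)) ↔
      Tendsto (fun p : ι × ι => F p.1 x - F p.2 x) (l ×ˢ l) (𝓝 0) := fun x => by
    rw [← cauchy_map_iff_exists_tendsto, cauchy_map_iff', uniformity_eq_comap_nhds_zero_swapped,
      tendsto_comap_iff]
    rfl
  simp_rw [h]
  refine isClosed_setOf_tendsto_zero (fun (p : ι × ι) x => F p.1 x - F p.2 x) (K + K) ?_
  filter_upwards [hF.prod_mk hF] with p hp x y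
  calc ‖F p.1 x - F p.2 x - (F p.1 y - F p.2 y)‖
      = ‖(F p.1 x - F p.1 y) - (F p.2 x - F p.2 y)‖ := by congr 1; abel
    _ ≤ ‖F p.1 x - F p.1 y‖ + ‖F p.2 x - F p.2 y‖ := norm_sub_le _ _
    _ ≤ (K + K) * ‖x - y‖ := by linarith [hp.1 x y, hp.2 x y]

/-- The points of convergence form a closed subspace because the operators are uniformly bounded,
and the bound passes to the limit operator. -/
lemma exists_tendsto_of_dense_span {ι E E' : Type*} [NormedAddCommGroup E] [NormedSpace ℂ E]
    [NormedAddCommGroup E'] [NormedSpace ℂ E'] [CompleteSpace E'] {l : Filter ι} [l.NeBot]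
    (F : ι → E →L[ℂ] E') (K : ℝ) (hF : ∀ᶠ u in l, ‖F u‖ ≤ K) {s : Set E}
    (hs : Dense (Submodule.span ℂ s : Set E))
    (h : ∀ x ∈ s, ∃ z, Tendsto (fun u => F u x) l (𝓝 z)) :
    ∃ G : E →L[ℂ] E', ∀ x, Tendsto (fun u => F u x) l (𝓝 (G x)) := by
  let D : Submodule ℂ E :=
    { carrier := {x | ∃ z, Tendsto (fun u => F u x) l (𝓝 z)}
      add_mem' := by
        rintro x y ⟨z, hz⟩ ⟨w, hw⟩
        exact ⟨z + w, by simpa using hz.add hw⟩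
      zero_mem' := ⟨0, by simp⟩
      smul_mem' := by
        rintro c x ⟨z, hz⟩
        exact ⟨c • z, by simpa using hz.const_smul c⟩ }
  have hD : IsClosed (D : Set E) := by
    refine isClosed_setOf_exists_tendsto (fun u x => F u x) K ?_
    filter_upwards [hF] with u hu x y
    rw [← map_sub]
    exact (F u).le_of_opNorm_le hu _
  have hall : ∀ x, ∃ z, Tendsto (fun u => F u x) l (𝓝 z) := fun x =>
    closure_minimal (Submodule.span_le.2 h : Submodule.span ℂ s ≤ D) hD (hs x)
  choose G hG using hall
  refine ⟨LinearMap.mkContinuous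
    { toFun := G
      map_add' := fun x y => tendsto_nhds_unique (hG _) (by simpa using (hG x).add (hG y))
      map_smul' := fun c x => tendsto_nhds_unique (hG _) (by simpa using (hG x).const_smul c) }
    K fun x => ?_, hG⟩
  refine le_of_tendsto (hG x).norm ?_
  filter_upwards [hF] with u hu
  exact (F u).le_of_opNorm_le hu _

/-- A bounded net of elements converging strictly on sets with dense span converges strictly to a
multiplier. -/
lemma exists_multiplier_of_tendsto {ι B : Type*} [NonUnitalCStarAlgebra B] {l : Filter ι} [l.NeBot]
    (F : ι → B) (K : ℝ) (hF : ∀ᶠ u in l, ‖F u‖ ≤ K) {s t : Set B}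
    (hs : Dense (Submodule.span ℂ s : Set B)) (ht : Dense (Submodule.span ℂ t : Set B))
    (hsF : ∀ b ∈ s, ∃ z, Tendsto (fun u => F u * b) l (𝓝 z))
    (htF : ∀ b ∈ t, ∃ z, Tendsto (fun u => b * F u) l (𝓝 z)) :
    ∃ m : 𝓜(ℂ, B), (∀ b, Tendsto (fun u => F u * b) l (𝓝 (m.fst b))) ∧
      ∀ b, Tendsto (fun u => b * F u) l (𝓝 (m.snd b)) := by
  obtain ⟨G, hG⟩ := exists_tendsto_of_dense_span (fun u => ContinuousLinearMap.mul ℂ B (F u)) K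
    (hF.mono fun u hu => by simpa using hu) hs hsF
  obtain ⟨H, hH⟩ := exists_tendsto_of_dense_span
    (fun u => (ContinuousLinearMap.mul ℂ B).flip (F u)) K
    (hF.mono fun u hu => (ContinuousLinearMap.opNorm_le_bound _ (norm_nonneg _) fun b => by
      simpa [mul_comm] using norm_mul_le b (F u)).trans hu) ht htF
  -- The centralizer identity `H a * b = a * G b` holds because both sides are limits of `a * F u *
  -- b`.
  refine ⟨⟨(G, H), fun a b => ?_⟩, hG, hH⟩
  refine tendsto_nhds_unique ((hH a).mul_const b) ?_
  simpa [mul_assoc] using (hG b).const_mul a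

end Limits

/-! ### Products of multipliers with elements of the algebra. -/

namespace DoubleCentralizer

variable {B : Type*} [NonUnitalCStarAlgebra B]

/-- The norm of a multiplier is that of its left component. -/
lemma ext_fst {m n : 𝓜(ℂ, B)} (h : ∀ b, m.fst b = n.fst b) : m = n := by
  have h0 : m - n = 0 := by
    rw [← norm_eq_zero, ← norm_fst, sub_fst, sub_eq_zero.2 (ContinuousLinearMap.ext h), norm_zero]
  exact sub_eq_zero.1 h0

lemma coe_mul_multiplier (b : B) (m : 𝓜(ℂ, B)) : (b : 𝓜(ℂ, B)) * m = (m.snd b : 𝓜(ℂ, B)) :=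
  ext_fst fun c => (m.central b c).symm

lemma multiplier_mul_coe (b : B) (m : 𝓜(ℂ, B)) : m * (b : 𝓜(ℂ, B)) = (m.fst b : 𝓜(ℂ, B)) := by
  rw [← star_inj, star_mul]
  change _ * _ = star (coeHom (m.fst b))
  rw [← map_star]
  change star (coeHom b) * _ = _
  rw [← map_star]
  refine (coe_mul_multiplier _ _).trans ?_
  rw [star_snd, star_star]
  rfl

lemma coe_mul (a b : B) : ((a * b : B) : 𝓜(ℂ, B)) = (a : 𝓜(ℂ, B)) * (b : 𝓜(ℂ, B)) :=
  map_mul (coeHom (𝕜 := ℂ)) a b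

lemma coe_star (a : B) : ((star a : B) : 𝓜(ℂ, B)) = star (a : 𝓜(ℂ, B)) :=
  map_star (coeHom (𝕜 := ℂ)) a

/-- If `a` and `b` act equally from the left, then `(a - b) * star (a - b) = 0`, and the
`C⋆`-identity gives `a = b`. -/
lemma coe_inj {a b : B} : (a : 𝓜(ℂ, B)) = b ↔ a = b := by
  refine ⟨fun h => ?_, fun h => h ▸ rfl⟩
  rw [← sub_eq_zero, ← norm_eq_zero, ← mul_self_eq_zero, ← CStarRing.norm_self_mul_star, sub_mul]
  have h1 := congrArg (fun m : 𝓜(ℂ, B) => m.fst (star (a - b))) h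
  simp only [coe_fst, ContinuousLinearMap.mul_apply'] at h1
  rw [h1, sub_self, norm_zero]

lemma fst_mul (m : 𝓜(ℂ, B)) (a b : B) : m.fst (a * b) = m.fst a * b := by
  rw [← coe_inj, ← multiplier_mul_coe, coe_mul, coe_mul, ← multiplier_mul_coe, mul_assoc]

lemma snd_mul (m : 𝓜(ℂ, B)) (a b : B) : m.snd (a * b) = a * m.snd b := by
  rw [← coe_inj, ← coe_mul_multiplier, coe_mul, coe_mul, ← coe_mul_multiplier, mul_assoc]

end DoubleCentralizer

/-! ### Approximate units -/

section ApproximateUnit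

open Filter Topology

variable {A : Type*} [NonUnitalCStarAlgebra A]

variable {B : Type*} [NonUnitalCStarAlgebra B] {π : A →⋆ₙₐ[ℂ] B}

/-- On products `π a * c` this is `u * a → a`; contractivity of `π u` and density do the rest. -/
lemma IsNondegenerate.tendsto_map_mul (hπ : IsNondegenerate π) (b : B) :
    Tendsto (fun u => π u * b) (CStarAlgebra.approximateUnit A) (𝓝 b) := by
  have hl := CStarAlgebra.increasingApproximateUnit (A := A)
  have hs : ∀ x ∈ {x : B | ∃ a b, x = π a * b},
      Tendsto (fun u => π u * x) (CStarAlgebra.approximateUnit A) (𝓝 x) := by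
    rintro _ ⟨a, c, rfl⟩
    have := (((map_continuous π).tendsto a).comp (hl.tendsto_mul_right a)).mul_const c
    refine this.congr fun u => ?_
    simp [mul_assoc]
  obtain ⟨G, hG⟩ := exists_tendsto_of_dense_span
    (fun u => ContinuousLinearMap.mul ℂ B (π u)) 1
    (hl.eventually_norm.mono fun u hu => by
      simpa using (NonUnitalStarAlgHom.norm_apply_le π u).trans hu) hπ fun x hx => ⟨x, hs x hx⟩
  have hid : G = ContinuousLinearMap.id ℂ B :=
    ContinuousLinearMap.ext_on hπ fun x hx => tendsto_nhds_unique (hG x) (hs x hx)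
  simpa [hid] using hG b

lemma IsNondegenerate.tendsto_mul_map (hπ : IsNondegenerate π) (b : B) :
    Tendsto (fun u => b * π u) (CStarAlgebra.approximateUnit A) (𝓝 b) := by
  have hl := CStarAlgebra.increasingApproximateUnit (A := A)
  have h := (hπ.tendsto_map_mul (star b)).star
  rw [star_star] at h
  refine h.congr' ?_
  filter_upwards [hl.eventually_star_eq] with u hu
  rw [star_mul, star_star, ← map_star, hu]

lemma IsNondegenerate.dense_span_mul_map (hπ : IsNondegenerate π) :
    Dense (Submodule.span ℂ {x : B | ∃ a b, x = b * π a} : Set B) := fun b =>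
  mem_closure_of_tendsto (hπ.tendsto_mul_map b)
    (.of_forall fun u => Submodule.subset_span ⟨u, b, rfl⟩)

lemma isNondegenerate_of_tendsto
    (h : ∀ b, Tendsto (fun u => π u * b) (CStarAlgebra.approximateUnit A) (𝓝 b)) :
    IsNondegenerate π := fun b =>
  mem_closure_of_tendsto (h b) (.of_forall fun u => Submodule.subset_span ⟨u, b, rfl⟩)

/-- The `C⋆`-identity gives `‖b π(u) - b‖² ≤ 2 ‖a u - a‖`. Applied to `b = ψ x`, this shows that
`π(u)` acts as a right approximate unit on the range of a Toeplitz representation. -/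
lemma tendsto_mul_map_of_star_mul_self_eq {b : B} {a : A} (h : star b * b = π a) :
    Tendsto (fun u => b * π u) (CStarAlgebra.approximateUnit A) (𝓝 b) := by
  have hl := CStarAlgebra.increasingApproximateUnit (A := A)
  rw [tendsto_iff_norm_sub_tendsto_zero]
  have h1 : Tendsto (fun u => √(2 * ‖a * u - a‖)) (CStarAlgebra.approximateUnit A) (𝓝 0) := by
    have := ((hl.tendsto_mul_left a).sub_const a).norm.const_mul 2
    simpa using this.sqrt
  refine squeeze_zero' (.of_forall fun u => norm_nonneg _) ?_ h1
  filter_upwards [hl.eventually_norm] with u hu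
  refine Real.le_sqrt_of_sq_le ?_
  have h2 : star (b * π u - b) * (b * π u - b)
      = star (π u) * π (a * u - a) - π (a * u - a) := by
    rw [map_sub, map_mul, ← h]
    simp only [star_sub, star_mul, sub_mul, mul_sub, mul_assoc]
    abel
  rw [sq, ← CStarRing.norm_star_mul_self, h2]
  have h3 : ‖star (π u)‖ ≤ 1 := by
    rw [norm_star]
    exact (NonUnitalStarAlgHom.norm_apply_le π u).trans hu
  have h4 := NonUnitalStarAlgHom.norm_apply_le π (a * u - a)
  calc _ ≤ ‖star (π u)‖ * ‖π (a * u - a)‖ + ‖π (a * u - a)‖ :=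
        (norm_sub_le _ _).trans (by gcongr; exact norm_mul_le _ _)
    _ ≤ 1 * ‖a * u - a‖ + ‖a * u - a‖ := by gcongr
    _ = _ := by ring

variable (π) in
lemma isClosed_setOf_tendsto_map_mul :
    IsClosed {b : B | Tendsto (fun u => π u * b) (CStarAlgebra.approximateUnit A) (𝓝 b)} := by
  have hl := CStarAlgebra.increasingApproximateUnit (A := A)
  convert isClosed_setOf_tendsto_zero (l := CStarAlgebra.approximateUnit A)
    (fun u b => π u * b - b) 2 ?_ using 3 with b
  · exact tendsto_sub_nhds_zero_iff.symm
  filter_upwards [hl.eventually_norm] with u hu x y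
  have h3 := (NonUnitalStarAlgHom.norm_apply_le π u).trans hu
  calc ‖π u * x - x - (π u * y - y)‖ = ‖π u * (x - y) - (x - y)‖ := by
        rw [mul_sub]; congr 1; abel
    _ ≤ ‖π u‖ * ‖x - y‖ + ‖x - y‖ :=
        (norm_sub_le _ _).trans (by gcongr; exact norm_mul_le _ _)
    _ ≤ 1 * ‖x - y‖ + ‖x - y‖ := by gcongr
    _ = _ := by ring

/-- Left and right convergence are carried through the induction together, because taking adjoints
interchanges them. -/
lemma isNondegenerate_of_generates {s : Set B}
    (hs : (NonUnitalStarAlgebra.adjoin ℂ s).topologicalClosure = ⊤)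
    (h1 : ∀ b ∈ s, Tendsto (fun u => π u * b) (CStarAlgebra.approximateUnit A) (𝓝 b))
    (h2 : ∀ b ∈ s, Tendsto (fun u => b * π u) (CStarAlgebra.approximateUnit A) (𝓝 b)) :
    IsNondegenerate π := by
  have hl := CStarAlgebra.increasingApproximateUnit (A := A)
  refine isNondegenerate_of_tendsto ?_
  suffices h : ∀ b, b ∈ (NonUnitalStarAlgebra.adjoin ℂ s) →
      Tendsto (fun u => π u * b) (CStarAlgebra.approximateUnit A) (𝓝 b) ∧
      Tendsto (fun u => b * π u) (CStarAlgebra.approximateUnit A) (𝓝 b) by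
    intro b
    have hb : b ∈ (NonUnitalStarAlgebra.adjoin ℂ s).topologicalClosure := hs ▸ trivial
    exact closure_minimal (fun c hc => (h c hc).1) (isClosed_setOf_tendsto_map_mul π) hb
  intro b hb
  induction hb using NonUnitalStarAlgebra.adjoin_induction with
  | mem x hx => exact ⟨h1 x hx, h2 x hx⟩
  | add x y _ _ hx hy =>
    simp only [mul_add, add_mul]
    exact ⟨hx.1.add hy.1, hx.2.add hy.2⟩
  | zero => simp
  | mul x y _ _ hx hy =>
    exact ⟨(hx.1.mul_const y).congr fun u => mul_assoc _ _ _,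
      (hy.2.const_mul x).congr fun u => (mul_assoc _ _ _).symm⟩
  | smul c x _ hx =>
    simp only [mul_smul_comm, smul_mul_assoc]
    exact ⟨hx.1.const_smul c, hx.2.const_smul c⟩
  | star x _ hx =>
    refine ⟨hx.2.star.congr' ?_, hx.1.star.congr' ?_⟩ <;>
    · filter_upwards [hl.eventually_star_eq] with u hu
      rw [star_mul, ← map_star, hu]

end ApproximateUnit

/-! ### Toeplitz representations -/

section ToeplitzRep

variable {A : Type u} [NonUnitalCStarAlgebra A] {M : Type v} [NormedAddCommGroup M]
  [NormedSpace ℂ M] [CompleteSpace M] {H : HilbertBimodule A M} {B : Type*}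
  [NonUnitalCStarAlgebra B] {ψ : M →ₗ[ℂ] B} {π : A →⋆ₙₐ[ℂ] B}

/-- This is the a priori bound on generators needed for a universal algebra, and it makes `ψ`
continuous although only linearity is assumed. -/
lemma IsToeplitzRep.norm_map_le (h : IsToeplitzRep H ψ π) (x : M) : ‖ψ x‖ ≤ ‖x‖ := by
  rw [← sq_le_sq₀ (norm_nonneg _) (norm_nonneg _), H.norm_sq_eq, sq,
    ← CStarRing.norm_star_mul_self, h.star_mul_map]
  exact NonUnitalStarAlgHom.norm_apply_le π _

lemma IsToeplitzRep.continuous (h : IsToeplitzRep H ψ π) : Continuous ψ :=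
  AddMonoidHomClass.continuous_of_bound ψ 1 fun x => by simpa using h.norm_map_le x

/-- Linearity, multiplicativity and the Toeplitz relations are all equations, so they can be tested
under every `ρ i`. -/
lemma IsToeplitzRep.of_jointly_faithful {ι : Type*} {C : ι → Type*}
    [∀ i, NonUnitalCStarAlgebra (C i)] (ρ : ∀ i, B →⋆ₙₐ[ℂ] C i)
    (hρ : ∀ x y, (∀ i, ρ i x = ρ i y) → x = y) (f : M → B) (g : A → B)
    (h : ∀ i, ∃ (ψ : M →ₗ[ℂ] C i) (π : A →⋆ₙₐ[ℂ] C i), IsToeplitzRep H ψ π ∧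
      (∀ x, ρ i (f x) = ψ x) ∧ ∀ a, ρ i (g a) = π a) :
    ∃ (ψ : M →ₗ[ℂ] B) (π : A →⋆ₙₐ[ℂ] B), IsToeplitzRep H ψ π ∧ (∀ x, f x = ψ x) ∧
      ∀ a, g a = π a := by
  choose ψ π hrep hψ hπ using h
  refine ⟨{ toFun := f, map_add' := fun x y => ?_, map_smul' := fun c x => ?_ },
    { toFun := g, map_smul' := fun c x => ?_, map_zero' := ?_, map_add' := fun x y => ?_,
      map_mul' := fun x y => ?_, map_star' := fun x => ?_ },
    ⟨fun x a => ?_, fun x y => ?_, fun a x => ?_⟩, fun _ => rfl, fun _ => rfl⟩ <;>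
  refine hρ _ _ fun i => ?_
  · simp [hψ]
  · simp [hψ]
  · simp [hπ]
  · simp [hπ]
  · simp [hπ]
  · simp [hπ]
  · simp [hπ, map_star]
  · simpa [hπ, hψ] using (hrep i).map_rsmul x a
  · simpa [hπ, hψ, map_star] using (hrep i).star_mul_map x y
  · simpa [hπ, hψ] using (hrep i).map_φ a x

end ToeplitzRep

theorem exists_isToeplitzAlgebra {A M : Type u} [NonUnitalCStarAlgebra A] [NormedAddCommGroup M]
    [NormedSpace ℂ M] [CompleteSpace M] (H : HilbertBimodule A M) :
    ∃ (T : Type u) (_ : NonUnitalCStarAlgebra T) (iM : M →ₗ[ℂ] T) (iA : A →⋆ₙₐ[ℂ] T),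
      IsToeplitzAlgebra H iM iA := by
  obtain ⟨T, _, g, ⟨iM, iA, hrep, hM, hA⟩, hgen, huniv⟩ := exists_universal_cstarAlgebra
    (G := M ⊕ A) (fun B _ f => ∃ (ψ : M →ₗ[ℂ] B) (π : A →⋆ₙₐ[ℂ] B), IsToeplitzRep H ψ π ∧
      (∀ x, f (.inl x) = ψ x) ∧ ∀ a, f (.inr a) = π a)
    (Sum.elim (fun x => ‖x‖) fun a => ‖a‖)
    (by
      rintro B _ f ⟨ψ, π, hrep, hψ, hπ⟩ (x | a)
      · simpa [hψ] using hrep.norm_map_le x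
      · simpa [hπ] using NonUnitalStarAlgHom.norm_apply_le π a)
    (fun C _ g ι B _ ρ hρ h => IsToeplitzRep.of_jointly_faithful ρ hρ _ _ h)
  refine ⟨T, inferInstance, iM, iA, hrep, ?_, fun B _ ψ π h => ?_⟩
  · convert hgen using 3
    ext t
    simp [hM, hA]
  · obtain ⟨Φ, hΦ⟩ := huniv B (Sum.elim ψ π) ⟨ψ, π, h, fun _ => rfl, fun _ => rfl⟩
    exact ⟨Φ, fun x => by rw [← hM, hΦ]; rfl, fun a => by rw [← hA, hΦ]; rfl⟩

/-! ### Toeplitz-covariant representations -/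

namespace ExelSystem

open Filter Topology DoubleCentralizer

variable {A : Type u} [NonUnitalCStarAlgebra A] (X : ExelSystem A)

lemma norm_q_le (a : A) : ‖X.q a‖ ≤ √‖X.L‖ * ‖a‖ := by
  rw [← sq_le_sq₀ (norm_nonneg _) (by positivity), mul_pow, Real.sq_sqrt (norm_nonneg _),
    X.norm_sq_q, sq ‖a‖, ← CStarRing.norm_star_mul_self]
  exact X.L.le_opNorm _

lemma continuous_q : Continuous X.q :=
  AddMonoidHomClass.continuous_of_bound X.q _ X.norm_q_le

variable {X} {B : Type*} [NonUnitalCStarAlgebra B] {π : A →⋆ₙₐ[ℂ] B}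

/-- This is `star_mul_map_mul` at `star a * b`: `(π(a) V)⋆ (π(b) V) = V⋆ π(a⋆ b) V`. -/
lemma _root_.IsToeplitzCovariantRep.star_snd_mul_snd {V : 𝓜(ℂ, B)}
    (h : IsToeplitzCovariantRep X π V) (a b : A) :
    star (V.snd (π a)) * V.snd (π b) = π (X.L (star a * b)) := by
  rw [← coe_inj, coe_mul, coe_star, ← coe_mul_multiplier, ← coe_mul_multiplier, star_mul,
    ← coe_star, ← h.star_mul_map_mul, map_mul, coe_mul, map_star]
  simp only [mul_assoc]

/-- A Toeplitz-covariant representation `(π, V)` yields a Toeplitz representation of `M_L`. -/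
theorem _root_.IsToeplitzCovariantRep.exists_isToeplitzRep {V : 𝓜(ℂ, B)}
    (h : IsToeplitzCovariantRep X π V) :
    ∃ ψ : X.ML →ₗ[ℂ] B, IsToeplitzRep X.bimodule ψ π ∧ ∀ a, ψ (X.q a) = V.snd (π a) := by
  let f : A →ₗ[ℂ] B := (V.snd : B →ₗ[ℂ] B) ∘ₗ (π : A →ₗ[ℂ] B)
  -- Since `‖π(a) V‖² = ‖π(L(a⋆ a))‖ ≤ ‖q a‖²`, the map `a ↦ π(a) V` descends along `q` and extends
  -- to the completion.
  have hbd : ∀ a, ‖f a‖ ≤ 1 * ‖X.q a‖ := fun a => by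
    rw [one_mul, ← sq_le_sq₀ (norm_nonneg _) (norm_nonneg _), X.norm_sq_q, sq,
      ← CStarRing.norm_star_mul_self]
    exact (congrArg norm (h.star_snd_mul_snd a a)).trans_le (NonUnitalStarAlgHom.norm_apply_le π _)
  let ψ : X.ML →L[ℂ] B := f.extendOfNorm X.q
  have hψ : ∀ a, ψ (X.q a) = V.snd (π a) :=
    LinearMap.extendOfNorm_eq X.denseRange_q ⟨1, hbd⟩
  have hπ := map_continuous π
  refine ⟨ψ, ⟨fun x a => ?_, fun x y => ?_, fun a x => ?_⟩, hψ⟩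
  · change ψ (X.rightML x a) = ψ x * π a
    refine X.denseRange_q.induction_on x (isClosed_eq (by fun_prop) (by fun_prop)) fun m => ?_
    rw [X.rightML_q, hψ, hψ, ← coe_inj, ← coe_mul_multiplier, coe_mul, ← coe_mul_multiplier,
      mul_assoc, h.mul_map, map_mul, coe_mul, mul_assoc]
  · change star (ψ x) * ψ y = π (X.innerML x y)
    refine X.denseRange_q.induction_on₂ (isClosed_eq (by fun_prop) (by fun_prop)) (fun m n => ?_) x y
    rw [X.innerML_q, hψ, hψ, h.star_snd_mul_snd]
  · change ψ (X.leftML a x) = π a * ψ x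
    refine X.denseRange_q.induction_on x (isClosed_eq (by fun_prop) (by fun_prop)) fun m => ?_
    rw [X.leftML_q, hψ, hψ, ← coe_inj, ← coe_mul_multiplier, coe_mul, ← coe_mul_multiplier,
      map_mul, coe_mul, mul_assoc]

lemma _root_.IsToeplitzRep.map_q_mul {ψ : X.ML →ₗ[ℂ] B} (h : IsToeplitzRep X.bimodule ψ π)
    (a b : A) : ψ (X.q (a * b)) = π a * ψ (X.q b) := by
  rw [← X.leftML_q]
  exact h.map_φ a (X.q b)

lemma _root_.IsToeplitzRep.map_q_mul_α {ψ : X.ML →ₗ[ℂ] B} (h : IsToeplitzRep X.bimodule ψ π)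
    (a b : A) : ψ (X.q (a * X.α b)) = ψ (X.q a) * π b := by
  rw [← X.rightML_q]
  exact h.map_rsmul (X.q a) b

/-- A Toeplitz representation `(ψ, π)` of `M_L` with `π` nondegenerate comes from a
Toeplitz-covariant representation `(π, V)`, where `V` is the strict limit of `ψ (q u)` as `u` runs
through an approximate unit. -/
theorem _root_.IsToeplitzRep.exists_isToeplitzCovariantRep {ψ : X.ML →ₗ[ℂ] B}
    (h : IsToeplitzRep X.bimodule ψ π) (hπ : IsNondegenerate π) :
    ∃ V : 𝓜(ℂ, B), IsToeplitzCovariantRep X π V ∧ ∀ a, V.snd (π a) = ψ (X.q a) := by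
  have hl := CStarAlgebra.increasingApproximateUnit (A := A)
  have hcont : Continuous fun a => ψ (X.q a) := h.continuous.comp X.continuous_q
  have hα : Continuous X.α := map_continuous X.α
  -- The right action moves `π a` inside as `u * α a`, which tends to `α a` even if `α` is
  -- degenerate.
  have hleft : ∀ a b, Tendsto (fun u => ψ (X.q u) * (π a * b)) (CStarAlgebra.approximateUnit A)
      (𝓝 (ψ (X.q (X.α a)) * b)) := fun a b => by
    have := ((hcont.tendsto _).comp (hl.tendsto_mul_right (X.α a))).mul_const b
    refine this.congr fun u => ?_
    simp only [Function.comp_apply, h.map_q_mul_α, mul_assoc]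
  have hright : ∀ a b, Tendsto (fun u => b * π a * ψ (X.q u)) (CStarAlgebra.approximateUnit A)
      (𝓝 (b * ψ (X.q a))) := fun a b => by
    have := ((hcont.tendsto _).comp (hl.tendsto_mul_left a)).const_mul b
    refine this.congr fun u => ?_
    simp only [Function.comp_apply, h.map_q_mul, mul_assoc]
  obtain ⟨V, hfst, hsnd⟩ := exists_multiplier_of_tendsto (fun u => ψ (X.q u)) √‖X.L‖
    (hl.eventually_norm.mono fun u hu => (h.norm_map_le _).trans <| (X.norm_q_le u).trans <|
      mul_le_of_le_one_right (Real.sqrt_nonneg _) hu) hπ hπ.dense_span_mul_map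
    (by rintro _ ⟨a, b, rfl⟩; exact ⟨_, hleft a b⟩) (by rintro _ ⟨a, b, rfl⟩; exact ⟨_, hright a b⟩)
  have hV : ∀ a, V.snd (π a) = ψ (X.q a) := fun a => by
    refine tendsto_nhds_unique (hsnd (π a)) ?_
    refine ((hcont.tendsto _).comp (hl.tendsto_mul_left a)).congr fun u => ?_
    simp only [Function.comp_apply, h.map_q_mul]
  refine ⟨V, ⟨hπ, fun a => ?_, fun a => ?_⟩, hV⟩
  · rw [coe_mul_multiplier, multiplier_mul_coe, hV, coe_inj]
    -- Both `V π(a)` and `π(α a) V` are equal to `ψ (q (α a))`.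
    refine tendsto_nhds_unique (hfst (π a)) ?_
    refine ((hcont.tendsto _).comp (hl.tendsto_mul_right (X.α a))).congr fun u => ?_
    simp only [Function.comp_apply, h.map_q_mul_α]
  -- The inner product relation only gives the identity on products `star b * c`; a general `a` is
  -- the limit of `u * a`, and both sides are continuous.
  · have hmul : ∀ b c, star V * ((π (star b * c) : B) : 𝓜(ℂ, B)) * V
        = ((π (X.L (star b * c)) : B) : 𝓜(ℂ, B)) := fun b c => by
      have h1 : star (ψ (X.q b)) * ψ (X.q c) = π (X.L (star b * c)) := by
        rw [← X.innerML_q]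
        exact h.star_mul_map (X.q b) (X.q c)
      rw [← h1, coe_mul, coe_star, ← hV, ← hV, ← coe_mul_multiplier, ← coe_mul_multiplier,
        star_mul, ← coe_star, map_mul, coe_mul, map_star]
      simp only [mul_assoc]
    have hcoe : Continuous fun b : B => (b : 𝓜(ℂ, B)) := map_continuous (coeHom (𝕜 := ℂ) (A := B))
    have hπc := map_continuous π
    have hclosed : IsClosed {a : A | star V * ((π a : B) : 𝓜(ℂ, B)) * V
        = ((π (X.L a) : B) : 𝓜(ℂ, B))} := isClosed_eq (by fun_prop) (by fun_prop)
    refine hclosed.mem_of_tendsto (hl.tendsto_mul_right a) (.of_forall fun u => ?_)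
    simpa using hmul (star u) a

/-- In a `C⋆`-algebra generated by a Toeplitz representation of `M_L`, the copy of `A` is
nondegenerate. -/
theorem _root_.IsToeplitzRep.isNondegenerate {ψ : X.ML →ₗ[ℂ] B} (h : IsToeplitzRep X.bimodule ψ π)
    (hgen : (NonUnitalStarAlgebra.adjoin ℂ (Set.range ψ ∪ Set.range π)).topologicalClosure = ⊤) :
    IsNondegenerate π := by
  have hl := CStarAlgebra.increasingApproximateUnit (A := A)
  have hcont : Continuous fun a => ψ (X.q a) := h.continuous.comp X.continuous_q
  refine isNondegenerate_of_generates hgen ?_ ?_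
  · rintro _ (⟨x, rfl⟩ | ⟨a, rfl⟩)
    · refine X.denseRange_q.induction_on x
        ((isClosed_setOf_tendsto_map_mul π).preimage h.continuous) fun m => ?_
      refine ((hcont.tendsto _).comp (hl.tendsto_mul_right m)).congr fun u => ?_
      simp only [Function.comp_apply, h.map_q_mul]
    · refine (((map_continuous π).tendsto a).comp (hl.tendsto_mul_right a)).congr fun u => ?_
      simp
  · rintro _ (⟨x, rfl⟩ | ⟨a, rfl⟩)
    -- Here `star (ψ x) * ψ x` lies in the range of `π`, so no density argument is needed on this
    -- side.
    · exact tendsto_mul_map_of_star_mul_self_eq (h.star_mul_map x x)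
    · refine (((map_continuous π).tendsto a).comp (hl.tendsto_mul_left a)).congr fun u => ?_
      simp

end ExelSystem

/-! ### Comparison of the two universal algebras. -/

open DoubleCentralizer in
/-- The Toeplitz algebra of `M_L` is a Toeplitz crossed product. -/
theorem IsToeplitzAlgebra.isToeplitzCrossedProduct {A : Type u} [NonUnitalCStarAlgebra A]
    {X : ExelSystem A} {T : Type u} [NonUnitalCStarAlgebra T] {iM : X.ML →ₗ[ℂ] T}
    {iA : A →⋆ₙₐ[ℂ] T} (h : IsToeplitzAlgebra X.bimodule iM iA) {S : 𝓜(ℂ, T)}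
    (hS : IsToeplitzCovariantRep X iA S) (hSq : ∀ a, S.snd (iA a) = iM (X.q a)) :
    IsToeplitzCrossedProduct X iA S where
  isToeplitzCovariantRep := hS
  generates := by
    set D := (NonUnitalStarAlgebra.adjoin ℂ
      (Set.range iA ∪ Set.range fun a : A => S.snd (iA a))).topologicalClosure with hD
    have hclosed : IsClosed (D : Set T) := NonUnitalStarSubalgebra.isClosed_topologicalClosure _
    have hsub : Set.range iA ∪ (Set.range fun a : A => S.snd (iA a)) ⊆ D :=
      (NonUnitalStarAlgebra.subset_adjoin ℂ _).trans
        (NonUnitalStarSubalgebra.le_topologicalClosure _)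
    refine eq_top_iff.2 fun t _ =>
      mem_of_topologicalClosure_adjoin_eq_top h.generates D hclosed ?_ t
    rintro _ (⟨x, rfl⟩ | ⟨a, rfl⟩)
    · refine X.denseRange_q.induction_on x (hclosed.preimage h.isToeplitzRep.continuous) fun m => ?_
      exact hSq m ▸ hsub (.inr ⟨m, rfl⟩)
    · exact hsub (.inl ⟨a, rfl⟩)
  universal B _ π V hV := by
    obtain ⟨ψ, hψ, hψq⟩ := hV.exists_isToeplitzRep
    obtain ⟨Φ, hM, hA⟩ := h.universal B ψ π hψ
    have hΦ : Continuous Φ := map_continuous Φ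
    -- The covariance relation turns left multiplication by `V` and `S` into values of `ψ` and `iM`
    -- at `q (α a)`, which `Φ` matches. Nondegeneracy of `iA` then spreads the identity to all of
    -- `T`.
    have hcov : ∀ a, V.fst (π a) = Φ (S.fst (iA a)) := fun a => by
      have h1 := hV.mul_map a
      have h2 := hS.mul_map a
      rw [coe_mul_multiplier, multiplier_mul_coe, coe_inj] at h1 h2
      rw [h1, h2, hSq, hM, hψq]
    let Φ' : T →L[ℂ] B := ⟨(Φ : T →ₗ[ℂ] B), hΦ⟩
    refine ⟨Φ, hA, fun t => ?_, fun t => ?_⟩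
    · refine DFunLike.congr_fun (ContinuousLinearMap.ext_on hS.nondegenerate
        (f := V.fst ∘L Φ') (g := Φ' ∘L S.fst) ?_) t
      rintro _ ⟨a, b, rfl⟩
      change V.fst (Φ (iA a * b)) = Φ (S.fst (iA a * b))
      rw [map_mul, hA, fst_mul, fst_mul, map_mul, hcov]
    · refine DFunLike.congr_fun (ContinuousLinearMap.ext_on hS.nondegenerate.dense_span_mul_map
        (f := V.snd ∘L Φ') (g := Φ' ∘L S.snd) ?_) t
      rintro _ ⟨a, b, rfl⟩
      change V.snd (Φ (b * iA a)) = Φ (S.snd (b * iA a))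
      rw [map_mul, hA, snd_mul, snd_mul, map_mul, hSq, hM, hψq]

theorem proposition3p1 {A : Type u} [NonUnitalCStarAlgebra A] (X : ExelSystem A) :
    (∃ (T : Type u) (_ : NonUnitalCStarAlgebra T) (i : A →⋆ₙₐ[ℂ] T) (S : 𝓜(ℂ, T)),
      IsToeplitzCrossedProduct X i S) ∧
    (∃ (T' : Type u) (_ : NonUnitalCStarAlgebra T') (iM : X.ML →ₗ[ℂ] T') (iA : A →⋆ₙₐ[ℂ] T'),
      IsToeplitzAlgebra X.bimodule iM iA) ∧
    ∀ (T : Type u) [NonUnitalCStarAlgebra T] (i : A →⋆ₙₐ[ℂ] T) (S : 𝓜(ℂ, T)),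
      IsToeplitzCrossedProduct X i S →
      ∃ ψS : X.ML →ₗ[ℂ] T,
        (∀ a : A, (ψS (X.q a) : 𝓜(ℂ, T)) = (i a : 𝓜(ℂ, T)) * S) ∧
        IsToeplitzRep X.bimodule ψS i ∧
        ∀ (T' : Type u) [NonUnitalCStarAlgebra T'] (iM : X.ML →ₗ[ℂ] T') (iA : A →⋆ₙₐ[ℂ] T'),
          IsToeplitzAlgebra X.bimodule iM iA →
          ∃ Φ : T' ≃⋆ₐ[ℂ] T, (∀ x, Φ (iM x) = ψS x) ∧ (∀ a, Φ (iA a) = i a) := by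
  refine ⟨?_, exists_isToeplitzAlgebra X.bimodule, fun T _ i S h => ?_⟩
  -- The Toeplitz algebra, with the multiplier obtained as a strict limit, serves as the crossed
  -- product.
  · obtain ⟨T, _, iM, iA, h⟩ := exists_isToeplitzAlgebra X.bimodule
    obtain ⟨S, hS, hSq⟩ := h.isToeplitzRep.exists_isToeplitzCovariantRep
      (h.isToeplitzRep.isNondegenerate h.generates)
    exact ⟨T, inferInstance, iA, S, h.isToeplitzCrossedProduct hS hSq⟩
  obtain ⟨ψ, hψ, hψq⟩ := h.isToeplitzCovariantRep.exists_isToeplitzRep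
  refine ⟨ψ, fun a => by rw [hψq, DoubleCentralizer.coe_mul_multiplier], hψ,
    fun T' _ iM iA h' => ?_⟩
  obtain ⟨V, hV, hVq⟩ := h'.isToeplitzRep.exists_isToeplitzCovariantRep
    (h'.isToeplitzRep.isNondegenerate h'.generates)
  obtain ⟨Φ, hΦM, hΦA⟩ := h'.universal T ψ i hψ
  obtain ⟨Ψ, hΨi, -, hΨS⟩ := h.universal T' iA V hV
  -- On the dense set of vectors `q m`, `Ψ` sends `i(m) S` to `iA(m) V`, which is `iM (q m)`.
  have hΨψ : ∀ x, Ψ (ψ x) = iM x := fun x => by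
    refine X.denseRange_q.induction_on x (isClosed_eq ((map_continuous Ψ).comp hψ.continuous)
      h'.isToeplitzRep.continuous) fun m => ?_
    rw [hψq, ← hΨS, hΨi, hVq]
  have hΨΦ : ∀ t, (Ψ.comp Φ) t = (NonUnitalStarAlgHom.id ℂ T') t :=
    NonUnitalStarAlgHom.ext_of_topologicalClosure_adjoin_eq_top h'.generates (by
      rintro _ (⟨x, rfl⟩ | ⟨a, rfl⟩)
      · simp [hΦM, hΨψ]
      · simp [hΦA, hΨi])
  have hΦΨ : ∀ t, (Φ.comp Ψ) t = (NonUnitalStarAlgHom.id ℂ T) t :=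
    NonUnitalStarAlgHom.ext_of_topologicalClosure_adjoin_eq_top h.generates (by
      rintro _ (⟨a, rfl⟩ | ⟨a, rfl⟩)
      · simp [hΦA, hΨi]
      · simp [← hψq, hΦM, hΨψ])
  exact ⟨StarAlgEquiv.ofBijective Φ ⟨Function.LeftInverse.injective hΨΦ,
    Function.RightInverse.surjective hΦΨ⟩, hΦM, hΦA⟩
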